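/- Let $M$ be a Hausdorff, paracompact smooth ($C^\infty$) manifold modelled on a real separable Hilbert space, and let $\omega$ be a strong symplectic form on $M$, i.e. a smooth closed $2$-form such that for every $x\in M$ the map $T_xM\to (T_xM)^*$, $u\mapsto \omega_x(u,\cdot)$, is bijective. Let $\mathbb{R}^n$ act on $M$ almost periodically: there are a smooth action of a torus $(S^1)^N$ on $M$ and a continuous homomorphism $\mathbb{R}^n\to (S^1)^N$ whose composition is the given action. For $\xi\in\mathbb{R}^n$ let $X_\xi(x)=\frac{d}{dt}\big|_{t=0}(t\xi)\cdot x$ be the vector field generated by $\xi$. Let $\mu\colon M\to\mathbb{R}^n$ be a momentum map for the action, i.e. a smooth map such that, for every $\xi\in\mathbb{R}^n$, the component $\mu^\xi:=\langle\mu(\cdot),\xi\rangle\colon M\to\mathbb{R}$ satisfies $d\mu^\xi=\omega(X_\xi,\cdot)$. Fix $\xi\in\mathbb{R}^n$ such that $\mu^\xi$ is a Morse function, i.e. at each critical point $p$ the Hessian $H_p(\mu^\xi)$ is strongly nondegenerate (the map $T_pM\to (T_pM)^*$, $u\mapsto H_p(\mu^\xi)(u,\cdot)$, is bijective). Then no critical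 point of $\mu^\xi$ has index or coindex equal to $1$, where the index (resp. coindex) of $p$ is the supremum of the dimensions of the linear subspaces of $T_pM$ on which $H_p(\mu^\xi)$ is negative (resp. positive) definite. -/

import Mathlib

open scoped Manifold ContDiff

noncomputable section

namespace HilbertHamiltonian

/-! Manifolds are modelled on a real Hilbert space `E`, with model with corners `𝓘(ℝ, E)`,
so `TangentSpace 𝓘(ℝ, E) x` is the tangent space `T_x M`. -/

section Forms

variable (E : Type*) [NormedAddCommGroup E] [InnerProductSpace ℝ E]
  (M : Type*) [TopologicalSpace M] [ChartedSpace E M]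

/-- A (not necessarily smooth) differential 2-form on `M`: a continuous alternating bilinear form
on every tangent space. -/
abbrev TwoForm : Type _ :=
  (x : M) → (TangentSpace 𝓘(ℝ, E) x) [⋀^Fin 2]→L[ℝ] ℝ

variable {E M}

/-- The representative of the 2-form `Ω` in the chart `φ` at `x₀`, that is, the pullback
`(φ⁻¹)^* Ω`, as a map from `E` to alternating forms on `E` (meaningful on the target of `φ`). -/
def TwoForm.inChart (Ω : TwoForm E M) (x₀ : M) (y : E) : E [⋀^Fin 2]→L[ℝ] ℝ :=
  (Ω ((extChartAt 𝓘(ℝ, E) x₀).symm y)).compContinuousLinearMap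
    (mfderiv 𝓘(ℝ, E) 𝓘(ℝ, E) (extChartAt 𝓘(ℝ, E) x₀).symm y)

/-- A strong symplectic form: a smooth closed 2-form `Ω` such that, at each `x`, the map
`T_x M → (T_x M)^*`, `u ↦ Ω_x (u, ·)`, into the continuous dual is bijective. -/
structure TwoForm.IsStronglySymplectic (Ω : TwoForm E M) : Prop where
  smooth : ∀ x₀ : M, ContDiffOn ℝ ∞ (Ω.inChart x₀) (extChartAt 𝓘(ℝ, E) x₀).target
  closed : ∀ x₀ : M, ∀ y ∈ (extChartAt 𝓘(ℝ, E) x₀).target, extDeriv (Ω.inChart x₀) y = 0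
  nondegenerate : ∀ (x : M) (l : TangentSpace 𝓘(ℝ, E) x →L[ℝ] ℝ),
    ∃! u : TangentSpace 𝓘(ℝ, E) x, ∀ v : TangentSpace 𝓘(ℝ, E) x, Ω x ![u, v] = l v

end Forms

section Morse

variable {E : Type*} [NormedAddCommGroup E] [InnerProductSpace ℝ E]
  {M : Type*} [TopologicalSpace M] [ChartedSpace E M]

/-- `p` is a critical point of `f`: `df_p = 0`. -/
def IsCriticalPoint (f : M → ℝ) (p : M) : Prop :=
  mfderiv 𝓘(ℝ, E) 𝓘(ℝ, ℝ) f p = 0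

/-- The Hessian of `f` at (a critical point) `p`:
`H_p(f)(u, v) = d²(f ∘ φ⁻¹)|_{φ(p)} (dφ_p u, dφ_p v)`, where `φ` is the chart at `p`. -/
def hessian (f : M → ℝ) (p : M) (u v : TangentSpace 𝓘(ℝ, E) p) : ℝ :=
  fderiv ℝ (fderiv ℝ (f ∘ (extChartAt 𝓘(ℝ, E) p).symm)) (extChartAt 𝓘(ℝ, E) p p)
    (mfderiv 𝓘(ℝ, E) 𝓘(ℝ, E) (extChartAt 𝓘(ℝ, E) p) p u)
    (mfderiv 𝓘(ℝ, E) 𝓘(ℝ, E) (extChartAt 𝓘(ℝ, E) p) p v)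

/-- A Morse function: a smooth function all of whose critical points `p` are strongly
nondegenerate. By the Riesz representation theorem, the operator `A` on `T_p M` with
`H_p(f)(u, v) = ⟨A u, v⟩_p`, for any strong inner product on `T_p M`, is a linear isomorphism if
and only if `T_p M → (T_p M)^*`, `u ↦ H_p(f)(u, ·)`, is bijective. -/
def IsMorse (f : M → ℝ) : Prop :=
  ContMDiff 𝓘(ℝ, E) 𝓘(ℝ, ℝ) ∞ f ∧
    ∀ p : M, IsCriticalPoint (E := E) f p →
      ∀ l : TangentSpace 𝓘(ℝ, E) p →L[ℝ] ℝ,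
        ∃! u : TangentSpace 𝓘(ℝ, E) p, ∀ v : TangentSpace 𝓘(ℝ, E) p, hessian f p u v = l v

/-- The index of `p`: the supremum of the dimensions of the linear subspaces of `T_p M` on which
the Hessian is negative definite (possibly `⊤`). -/
def index (f : M → ℝ) (p : M) : ℕ∞ :=
  ⨆ (W : Submodule ℝ (TangentSpace 𝓘(ℝ, E) p))
    (_ : ∀ w ∈ W, w ≠ 0 → hessian f p w w < 0), Cardinal.toENat (Module.rank ℝ W)

/-- The coindex of `p`: the supremum of the dimensions of the linear subspaces of `T_p M` on which
the Hessian is positive definite (possibly `⊤`). -/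
def coindex (f : M → ℝ) (p : M) : ℕ∞ :=
  ⨆ (W : Submodule ℝ (TangentSpace 𝓘(ℝ, E) p))
    (_ : ∀ w ∈ W, w ≠ 0 → 0 < hessian f p w w), Cardinal.toENat (Module.rank ℝ W)

end Morse

section Actions

variable (E : Type*) [NormedAddCommGroup E] [InnerProductSpace ℝ E]
  (M : Type*) [TopologicalSpace M] [ChartedSpace E M]

/-- The action of the torus `(S¹)^N` on `M` is smooth, as a map `(S¹)^N × M → M`. -/
def IsSmoothTorusAction (N : ℕ) [MulAction (Fin N → Circle) M] : Prop :=
  ContMDiff ((ModelWithCorners.pi fun _ : Fin N => 𝓡 1).prod 𝓘(ℝ, E)) 𝓘(ℝ, E) ∞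
    (fun q : (Fin N → Circle) × M => q.1 • q.2)

/-- The `ℝⁿ` action on `M` is almost periodic: it is the composition of a continuous homomorphism
`ℝⁿ → (S¹)^N` and a smooth action of the torus `(S¹)^N` on `M`. -/
def IsAlmostPeriodic (n : ℕ) [AddAction (EuclideanSpace ℝ (Fin n)) M] : Prop :=
  ∃ (N : ℕ) (_ : MulAction (Fin N → Circle) M)
    (h : Multiplicative (EuclideanSpace ℝ (Fin n)) →* (Fin N → Circle)),
    IsSmoothTorusAction E M N ∧ Continuous h ∧
      ∀ (v : EuclideanSpace ℝ (Fin n)) (x : M), v +ᵥ x = h (Multiplicative.ofAdd v) • x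

variable {E M}

/-- The vector field on `M` generated by `ξ ∈ ℝⁿ`: `X_ξ(x) = d/dt|_{t=0} (tξ) · x`. -/
def fundamentalVectorField {n : ℕ} [AddAction (EuclideanSpace ℝ (Fin n)) M]
    (ξ : EuclideanSpace ℝ (Fin n)) (x : M) : TangentSpace 𝓘(ℝ, E) x :=
  (mfderiv 𝓘(ℝ, ℝ) 𝓘(ℝ, E) (fun t : ℝ => (t • ξ) +ᵥ x) 0 (1 : ℝ) : E)

/-- The component `μ^ξ = ⟨μ(·), ξ⟩` of `μ : M → ℝⁿ`. -/
def component {n : ℕ} (μ : M → EuclideanSpace ℝ (Fin n)) (ξ : EuclideanSpace ℝ (Fin n)) :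
    M → ℝ :=
  fun x => inner ℝ (μ x) ξ

/-- `μ` is a momentum map for the `ℝⁿ` action with respect to `Ω`: it is smooth and
`dμ^ξ = Ω(X_ξ, ·)` for all `ξ ∈ ℝⁿ`. -/
structure IsMomentumMap (Ω : TwoForm E M) {n : ℕ} [AddAction (EuclideanSpace ℝ (Fin n)) M]
    (μ : M → EuclideanSpace ℝ (Fin n)) : Prop where
  smooth : ContMDiff 𝓘(ℝ, E) 𝓘(ℝ, EuclideanSpace ℝ (Fin n)) ∞ μ
  hamiltonian : ∀ (ξ : EuclideanSpace ℝ (Fin n)) (x : M) (v : TangentSpace 𝓘(ℝ, E) x),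
    mfderiv 𝓘(ℝ, E) 𝓘(ℝ, ℝ) (component μ ξ) x v = Ω x ![fundamentalVectorField ξ x, v]

end Actions

end HilbertHamiltonian

end

/-! Nondegeneracy of `Ω` makes a critical point `p` a fixed point of the flow of `ξ`. Let `A t` be
the linearized flow at `p`, `L` its generator and `B` the Hessian. Differentiating Hamilton's
equation gives `B u v = Ω(L u, v)` (`chartHessian_eq`). Hence `L` is skew for `B`, and the Morse
condition makes it surjective. The operators `A t` are uniformly bounded, because they are
differentials of elements of a compact group, the stabilizer of `p` in the torus
(`IsAlmostPeriodic.exists_bound`).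

It remains to place each vector `w` with `B w w < 0` in a negative definite plane
(`exists_negDef_plane_of_bounded_orbit`). Along `c t = A t w` the value `B (c t) (c t)` is constant.
If no such plane exists, a reversed Cauchy-Schwarz inequality and continuity keep `B (c t) w ≤ B w w
< 0`. With `w = L z`, the derivative of `B (c t) z` is `-B (c t) w ≥ -B w w > 0`, so `B (c t) z`
grows linearly for `t ≥ 0`, contradicting boundedness. This excludes index one; the same argument
for `-B` excludes coindex one. -/

open Filter Topology

/-! ### Smoothness of one-parameter subgroups of a torus -/

/-- A continuous homomorphism `ℝ → S¹`, written additively on the source, is smooth. -/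
theorem Circle.contDiff_of_continuous_add (χ : ℝ → Circle) (hc : Continuous χ)
    (hadd : ∀ s t, χ (s + t) = χ s * χ t) : ContDiff ℝ ∞ (fun t => (χ t : ℂ)) := by
  set f : ℝ → ℂ := fun t => (χ t : ℂ) with hf
  have fc : Continuous f := continuous_induced_dom.comp hc
  have fadd : ∀ s t, f (s + t) = f s * f t := fun s t => by simp [hf, hadd]
  set F : ℝ → ℂ := fun t => ∫ s in (0 : ℝ)..t, f s with hF
  have dF : ∀ t, HasDerivAt F (f t) t := fun t => fc.integral_hasStrictDerivAt 0 t |>.hasDerivAt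
  obtain ⟨δ, hδ⟩ : ∃ δ, F δ ≠ 0 := by
    by_contra! h
    have : F = fun _ => 0 := funext h
    have h0 := dF 0
    rw [this] at h0
    exact (Circle.coe_ne_zero (χ 0)) (h0.unique (hasDerivAt_const _ _))
  -- Integrating `f (t + s) = f t * f s` over `s` from `0` to `δ` expresses `f` through its
  -- primitive, which has one more derivative, so regularity bootstraps.
  have key : ∀ t, f t * F δ = F (t + δ) - F t := by
    intro t
    rw [hF]
    simp only
    rw [intervalIntegral.integral_interval_sub_left (fc.intervalIntegrable _ _)
      (fc.intervalIntegrable _ _), ← intervalIntegral.integral_const_mul]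
    simp_rw [← fadd]
    rw [intervalIntegral.integral_comp_add_left (fun s => f s) t, add_zero]
  have step : ∀ n : ℕ, ContDiff ℝ n f := by
    intro n
    induction n with
    | zero => exact contDiff_zero.2 fc
    | succ n ih =>
      have hFn : ContDiff ℝ (n + 1 : ℕ) F := by
        rw [Nat.cast_add, Nat.cast_one, contDiff_succ_iff_deriv]
        refine ⟨fun t => (dF t).differentiableAt, by simp, ?_⟩
        rwa [funext fun t => (dF t).deriv]
      have : f = fun t => (F (t + δ) - F t) * (F δ)⁻¹ := by
        funext t; rw [← key, mul_inv_cancel_right₀ hδ]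
      rw [this]
      exact ((hFn.comp (contDiff_id.add contDiff_const)).sub hFn).mul contDiff_const
  exact contDiff_infty.2 step

/-- A continuous homomorphism `ℝ → S¹` is smooth as a map of manifolds. -/
theorem Circle.contMDiff_of_continuous_add (χ : ℝ → Circle) (hc : Continuous χ)
    (hadd : ∀ s t, χ (s + t) = χ s * χ t) : ContMDiff 𝓘(ℝ, ℝ) (𝓡 1) ∞ χ :=
  haveI : Fact (Module.finrank ℝ ℂ = 1 + 1) := finrank_real_complex_fact'
  (Circle.contDiff_of_continuous_add χ hc hadd).contMDiff.codRestrict_sphere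
    (fun _ => mem_sphere_zero_iff_norm.2 (Circle.norm_coe _))

/-- A map into a finite product of manifolds is smooth if all its components are. -/
theorem ContMDiff.pi_of_components {ι : Type*} [Fintype ι] {𝕜 : Type*} [NontriviallyNormedField 𝕜]
    {F : ι → Type*} [∀ i, NormedAddCommGroup (F i)] [∀ i, NormedSpace 𝕜 (F i)]
    {H : ι → Type*} [∀ i, TopologicalSpace (H i)] {I : ∀ i, ModelWithCorners 𝕜 (F i) (H i)}
    {X : ι → Type*} [∀ i, TopologicalSpace (X i)] [∀ i, ChartedSpace (H i) (X i)]
    {F' H' Y : Type*} [NormedAddCommGroup F'] [NormedSpace 𝕜 F'] [TopologicalSpace H']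
    {J : ModelWithCorners 𝕜 F' H'} [TopologicalSpace Y] [ChartedSpace H' Y]
    {n : ℕ∞ω} {f : Y → ∀ i, X i} (hf : ∀ i, ContMDiff J (I i) n fun y => f y i) :
    ContMDiff J (ModelWithCorners.pi I) n f := by
  intro y
  rw [contMDiffAt_iff]
  refine ⟨(continuous_pi fun i => (hf i).continuous).continuousAt, ?_⟩
  rw [contDiffWithinAt_pi]
  intro i
  exact (contMDiffAt_iff.1 (hf i y)).2

/-! ### Bounded orbits and negative definite planes -/

section LinearAlgebra
variable {V : Type*} [NormedAddCommGroup V] [NormedSpace ℝ V]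

/-- Let `L` be skew for the symmetric bilinear form `B`. If a solution `c` of the linear equation
`c' = L c` is bounded, starts at a vector `w` in the range of `L` and `B w w < 0`, then `B` is
negative definite on some plane containing `w`. -/
theorem exists_negDef_plane_of_bounded_orbit (B : V →L[ℝ] V →L[ℝ] ℝ)
    (hsymm : ∀ u v, B u v = B v u) (L : V →L[ℝ] V) (hskew : ∀ u, B (L u) u = 0)
    (w : V) (hw : B w w < 0) (hsurj : ∃ z, L z = w) (c : ℝ → V) (hc0 : c 0 = w)
    (hc : ∀ t, HasDerivAt c (L (c t)) t) (hbdd : ∃ C, ∀ t, ‖c t‖ ≤ C) :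
    ∃ u, ∀ a b : ℝ, (a ≠ 0 ∨ b ≠ 0) → B (a • u + b • w) (a • u + b • w) < 0 := by
  obtain ⟨z, rfl⟩ := hsurj
  obtain ⟨C, hC⟩ := hbdd
  set w := L z
  have skew2 : ∀ u v, B (L u) v = - B u (L v) := by
    intro u v
    have := hskew (u + v)
    simp only [map_add, add_apply, hskew] at this
    rw [hsymm u (L v)]
    linarith
  have dB : ∀ v t, HasDerivAt (fun t => B (c t) v) (B (L (c t)) v) t := fun v t =>
    ((B.flip v).hasFDerivAt.comp_hasDerivAt t (hc t))
  have norm_const : ∀ t, B (c t) (c t) = B w w := by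
    have hd : ∀ t, HasDerivAt (fun t => B (c t) (c t)) 0 t := by
      intro t
      have := (B.hasFDerivAt.comp_hasDerivAt t (hc t)).clm_apply (hc t)
      convert! this using 1
      simp only [Function.comp_apply]
      rw [skew2, hsymm]; ring
    intro t
    rw [is_const_of_deriv_eq_zero (fun t => (hd t).differentiableAt) (fun t => (hd t).deriv) t 0,
      hc0]
  by_contra! hno
  -- Two vectors of equal negative square `x` and mutual product `y` span a negative definite plane
  -- as soon as `|y| < -x`.
  have out : ∀ t, B w w < B (c t) w → - B w w ≤ B (c t) w := by
    intro t ht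
    by_contra! h
    obtain ⟨a, b, hab, h1⟩ := hno (c t)
    simp only [map_add, map_smul, add_apply, smul_apply,
      smul_eq_mul, norm_const, hsymm w (c t)] at h1
    set x := B w w
    set y := B (c t) w
    have h2 : 0 < a ^ 2 + b ^ 2 := by
      rcases hab with h | h <;> positivity
    -- The form satisfies `-2 (x (a² + b²) + 2 a b y) = (y - x) (a - b)² + (-x - y) (a + b)²`, and
    -- the right side is at least `2 δ (a² + b²)`.
    have key : ∀ δ, 0 < δ → δ ≤ y - x → δ ≤ -x - y → False := by
      intro δ hδ h3 h4
      have h5 := mul_le_mul_of_nonneg_right h3 (sq_nonneg (a - b))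
      have h6 := mul_le_mul_of_nonneg_right h4 (sq_nonneg (a + b))
      have h7 := mul_pos hδ h2
      nlinarith
    exact key (min (y - x) (-x - y)) (lt_min (by linarith) (by linarith)) (min_le_left _ _)
      (min_le_right _ _)
  -- The function starts at `B w w` and cannot enter the gap up to `-B w w`; to get past it, it
  -- would have to vanish somewhere.
  have le : ∀ t, B (c t) w ≤ B w w := by
    intro t
    by_contra! h
    have hcont : Continuous fun t => B (c t) w :=
      continuous_iff_continuousAt.2 fun t => (dB w t).continuousAt
    have h1 := out t h
    obtain ⟨s, hs⟩ := mem_range_of_exists_le_of_exists_ge (c := (0 : ℝ)) hcont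
      ⟨(0 : ℝ), by simpa [hc0] using hw.le⟩ ⟨t, by linarith⟩
    have := out s (by simpa [hs] using hw)
    simp only at hs
    linarith
  have grow : ∀ t, 0 ≤ t → (- B w w) * (t - 0) ≤ B (c t) z - B (c 0) z := by
    intro t ht
    refine mul_sub_le_image_sub_of_le_deriv (f := fun t => B (c t) z)
      (fun t => (dB z t).differentiableAt) (fun s => ?_) ht
    rw [(dB z s).deriv, skew2 (c s) z]
    exact neg_le_neg (le s)
  have bd : ∀ t, B (c t) z ≤ ‖B‖ * C * ‖z‖ := fun t =>
    (le_abs_self _).trans ((B.le_opNorm₂ _ _).trans (by gcongr; exact hC t))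
  set K := ‖B‖ * C * ‖z‖ - B (c 0) z
  have hK : 0 ≤ K := sub_nonneg.2 (bd 0)
  -- At this time the linear growth reaches `K + 1`, while boundedness allows at most `K`.
  have h1 := grow ((K + 1) / (- B w w)) (by apply div_nonneg <;> linarith)
  rw [sub_zero, mul_div_cancel₀ _ (by linarith)] at h1
  have := bd ((K + 1) / (- B w w))
  simp only [K] at *
  linarith

end LinearAlgebra

/-! ### Smooth flows and their differentials at fixed points -/

section Geometry

variable {E : Type*} [NormedAddCommGroup E] [NormedSpace ℝ E]
  {M : Type*} [TopologicalSpace M] [ChartedSpace E M] [IsManifold 𝓘(ℝ, E) ∞ M]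

/-- The differential at `p` of a self-map of `M`, as an endomorphism of the model space. It is
meaningful for maps fixing `p`. -/
noncomputable def fixedPointDifferential (f : M → M) (p : M) : E →L[ℝ] E :=
  mfderiv 𝓘(ℝ, E) 𝓘(ℝ, E) f p

/-- At parameters fixing `p`, the differential at `p` coincides with its expression in coordinates. -/
theorem inTangentCoordinates_fixedPoint {P : Type*} (f : P → M → M) (p : M) {a b : P}
    (ha : f a p = p) (hb : f b p = p) :
    inTangentCoordinates 𝓘(ℝ, E) 𝓘(ℝ, E) (fun _ => p) (fun a => f a p)
      (fun a => fixedPointDifferential (f a) p) a b = fixedPointDifferential (f b) p := by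
  have : IsManifold 𝓘(ℝ, E) 1 M := IsManifold.of_le (n := ∞) (by simp)
  rw [inTangentCoordinates_eq _ _ _ (by simp) (by simp [ha, hb])]
  simp only [ha, hb]
  ext v
  simp only [ContinuousLinearMap.comp_apply]
  -- Source and image are both `p`, read in the chart at `p`, so both coordinate changes are
  -- trivial.
  rw [(tangentBundleCore 𝓘(ℝ, E) M).coordChange_self (achart E p) p (mem_chart_source E p),
    (tangentBundleCore 𝓘(ℝ, E) M).coordChange_self (achart E p) p (mem_chart_source E p)]

/-- The differential at a fixed point depends continuously on parameters. -/
theorem continuousOn_fixedPointDifferential {P : Type*} [NormedAddCommGroup P] [NormedSpace ℝ P]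
    (f : P → M → M)
    (hf : ContMDiff (𝓘(ℝ, P).prod 𝓘(ℝ, E)) 𝓘(ℝ, E) ∞ (Function.uncurry f)) (p : M) :
    ContinuousOn (fun a => fixedPointDifferential (E := E) (f a) p) {a | f a p = p} := by
  intro a ha
  have : IsManifold 𝓘(ℝ, E) 1 M := IsManifold.of_le (n := ∞) (by simp)
  have h := (ContMDiffAt.mfderiv (m := 0) (x₀ := a) f (fun _ => p) (hf (a, p))
    contMDiffAt_const (by simp)).continuousAt.continuousWithinAt (s := {a | f a p = p})
  exact h.congr_of_mem (fun b hb => (inTangentCoordinates_fixedPoint f p ha hb).symm) ha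

/-- The differential at a common fixed point depends smoothly on parameters. -/
theorem contDiff_fixedPointDifferential {P : Type*} [NormedAddCommGroup P] [NormedSpace ℝ P]
    (f : P → M → M)
    (hf : ContMDiff (𝓘(ℝ, P).prod 𝓘(ℝ, E)) 𝓘(ℝ, E) ∞ (Function.uncurry f)) (p : M)
    (hp : ∀ t, f t p = p) :
    ContDiff ℝ ∞ (fun a => fixedPointDifferential (E := E) (f a) p) := by
  have : IsManifold 𝓘(ℝ, E) 1 M := IsManifold.of_le (n := ∞) (by simp)
  refine contMDiff_iff_contDiff.1 fun a => ?_
  have h := ContMDiffAt.mfderiv (m := ∞) (x₀ := a) f (fun _ => p) (hf (a, p))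
    contMDiffAt_const (by simp)
  exact h.congr_of_eventuallyEq
    (Eventually.of_forall fun b => (inTangentCoordinates_fixedPoint f p (hp a) (hp b)).symm)

/-- A curve with vanishing velocity is constant. -/
theorem eq_of_hasMFDerivAt_zero [CompleteSpace E] [T2Space M] (γ : ℝ → M)
    (h : ∀ t, HasMFDerivAt 𝓘(ℝ, ℝ) 𝓘(ℝ, E) γ t 0) (t : ℝ) : γ t = γ 0 := by
  have : IsManifold 𝓘(ℝ, E) 1 M := IsManifold.of_le (n := ∞) (by simp)
  -- Both `γ` and the constant curve are integral curves of the zero field, so uniqueness of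
  -- integral curves applies.
  have hz : ContMDiff 𝓘(ℝ, E) 𝓘(ℝ, E).tangent 1
      (fun x => (⟨x, 0⟩ : TangentBundle 𝓘(ℝ, E) M)) :=
    Bundle.contMDiff_zeroSection ℝ (TangentSpace 𝓘(ℝ, E) : M → Type _)
  have h0 : (1 : ℝ →L[ℝ] ℝ).smulRight (0 : E) = 0 := by ext; simp
  have h1 : IsMIntegralCurve (I := 𝓘(ℝ, E)) γ (fun _ => 0) := fun t =>
    (h t).congr_mfderiv h0.symm
  have h2 : IsMIntegralCurve (I := 𝓘(ℝ, E)) (fun _ : ℝ => γ 0) (fun _ => 0) := fun t =>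
    (hasMFDerivAt_const (I := 𝓘(ℝ, ℝ)) (I' := 𝓘(ℝ, E)) (γ 0) t).congr_mfderiv h0.symm
  exact congrFun (isMIntegralCurve_Ioo_eq_of_contMDiff_boundaryless (t₀ := 0) hz h1 h2 rfl) t

/-- A smooth flow, i.e. a smooth action of `ℝ`. -/
structure IsSmoothFlow (φ : ℝ → M → M) : Prop where
  smooth : ContMDiff (𝓘(ℝ, ℝ).prod 𝓘(ℝ, E)) 𝓘(ℝ, E) ∞ (Function.uncurry φ)
  zero : ∀ x, φ 0 x = x
  add : ∀ s t x, φ (s + t) x = φ s (φ t x)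

namespace IsSmoothFlow

omit [IsManifold 𝓘(ℝ, E) ∞ M] in
theorem contMDiff_orbit {φ : ℝ → M → M} (h : IsSmoothFlow (E := E) φ) (x : M) :
    ContMDiff 𝓘(ℝ, ℝ) 𝓘(ℝ, E) ∞ (fun t => φ t x) :=
  h.smooth.comp (contMDiff_id.prodMk contMDiff_const)

omit [IsManifold 𝓘(ℝ, E) ∞ M] in
theorem contMDiff_map {φ : ℝ → M → M} (h : IsSmoothFlow (E := E) φ) (t : ℝ) :
    ContMDiff 𝓘(ℝ, E) 𝓘(ℝ, E) ∞ (φ t) :=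
  h.smooth.comp (contMDiff_const.prodMk contMDiff_id)

/-- Zeros of the generating vector field are fixed points of the flow. -/
theorem fixed_of_velocity_eq_zero [CompleteSpace E] [T2Space M] {φ : ℝ → M → M}
    (h : IsSmoothFlow (E := E) φ) (p : M)
    (hp : mfderiv 𝓘(ℝ, ℝ) 𝓘(ℝ, E) (fun t => φ t p) 0 (1 : ℝ) = 0) (t : ℝ) : φ t p = p := by
  have h0 : HasMFDerivAt 𝓘(ℝ, ℝ) 𝓘(ℝ, E) (fun t => φ t p) 0 0 := by
    refine ((h.contMDiff_orbit p).mdifferentiable (by simp) 0).hasMFDerivAt.congr_mfderiv ?_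
    refine ContinuousLinearMap.ext fun (r : ℝ) => ?_
    have h1 := (mfderiv 𝓘(ℝ, ℝ) 𝓘(ℝ, E) (fun t => φ t p) 0).map_smul r (1 : ℝ)
    rw [hp, smul_zero] at h1
    have h2 : (r • (1 : ℝ) : ℝ) = r := by simp
    exact (congrArg (mfderiv 𝓘(ℝ, ℝ) 𝓘(ℝ, E) (fun t => φ t p) 0) h2).symm.trans h1
  -- Since `φ t p = φ s (φ (t - s) p)`, the velocity at time `s` is the image of the zero velocity
  -- at time `0` under the differential of `φ s`.
  have key : ∀ s, HasMFDerivAt 𝓘(ℝ, ℝ) 𝓘(ℝ, E) (fun t => φ t p) s 0 := by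
    intro s
    have hs : (fun t => φ t p) = φ s ∘ (fun t => φ t p) ∘ (fun t => t - s) := by
      funext t
      simp [← h.add]
    have h1 : HasMFDerivAt 𝓘(ℝ, ℝ) 𝓘(ℝ, ℝ) (fun t : ℝ => t - s) s (.id ℝ ℝ) :=
      ((hasFDerivAt_id s).sub_const s).hasMFDerivAt
    have h2 : HasMFDerivAt 𝓘(ℝ, ℝ) 𝓘(ℝ, E) (fun t => φ t p) (s - s) 0 := by
      rw [sub_self]; exact h0
    have h3 := (((h.contMDiff_map s).mdifferentiable (by simp)
      (φ (s - s) p)).hasMFDerivAt.comp (s - s) h2).comp (f := fun t : ℝ => t - s) s h1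
    rw [hs]
    refine h3.congr_mfderiv ?_
    rw [ContinuousLinearMap.comp_zero]
    rfl
  rw [eq_of_hasMFDerivAt_zero (E := E) (fun t => φ t p) key t, h.zero]

variable {φ : ℝ → M → M} (h : IsSmoothFlow (E := E) φ) {p : M} (hp : ∀ t, φ t p = p)
include h hp

omit [IsManifold 𝓘(ℝ, E) ∞ M] in
theorem fixedPointDifferential_add (s t : ℝ) :
    fixedPointDifferential (E := E) (φ (s + t)) p =
      (fixedPointDifferential (φ s) p).comp (fixedPointDifferential (φ t) p) := by
  have hst : φ (s + t) = φ s ∘ φ t := funext fun x => h.add s t x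
  unfold fixedPointDifferential
  rw [hst, mfderiv_comp_of_eq ((h.contMDiff_map s).mdifferentiable (by simp) p)
    ((h.contMDiff_map t).mdifferentiable (by simp) p) (hp t), hp t]
  rfl

omit [IsManifold 𝓘(ℝ, E) ∞ M] hp in
theorem fixedPointDifferential_zero :
    fixedPointDifferential (E := E) (φ 0) p = .id ℝ E := by
  have : φ 0 = id := funext h.zero
  unfold fixedPointDifferential
  rw [this]
  exact mfderiv_id

/-- Differentiate the group law `A s = A (s - t) ∘ A t` at `s = t`. -/
theorem hasDerivAt_fixedPointDifferential (t : ℝ) :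
    HasDerivAt (fun t => fixedPointDifferential (E := E) (φ t) p)
      ((deriv (fun t => fixedPointDifferential (E := E) (φ t) p) 0).comp
        (fixedPointDifferential (φ t) p)) t := by
  have hd : HasDerivAt (fun t => fixedPointDifferential (E := E) (φ t) p) _ (t - t) :=
    ((contDiff_fixedPointDifferential φ h.smooth p hp).differentiable (by simp) (t - t)).hasDerivAt
  have h1 := (hd.comp_sub_const t t).clm_comp (hasDerivAt_const t (fixedPointDifferential (φ t) p))
  have he : (fun s => fixedPointDifferential (E := E) (φ s) p) =
      fun s => (fixedPointDifferential (φ (s - t)) p).comp (fixedPointDifferential (φ t) p) := by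
    funext s
    rw [← h.fixedPointDifferential_add hp, sub_add_cancel]
  rw [sub_self, ContinuousLinearMap.comp_zero, add_zero] at h1
  exact h1.congr_of_eventuallyEq (Eventually.of_forall (congrFun he))

end IsSmoothFlow

end Geometry

/-! ### Almost periodic actions -/

namespace HilbertHamiltonian

section

variable {E : Type*} [NormedAddCommGroup E] [InnerProductSpace ℝ E]
  {M : Type*} [TopologicalSpace M] [ChartedSpace E M]
  {n : ℕ} [AddAction (EuclideanSpace ℝ (Fin n)) M]

/-- The one-parameter subgroups of an almost periodic action are smooth flows. -/
theorem IsAlmostPeriodic.isSmoothFlow (hact : IsAlmostPeriodic E M n)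
    (ξ : EuclideanSpace ℝ (Fin n)) :
    IsSmoothFlow (E := E) (fun (t : ℝ) (x : M) => (t • ξ) +ᵥ x) := by
  refine ⟨?_, fun x => by simp, fun s t x => by rw [add_smul, add_vadd]⟩
  obtain ⟨N, act, h, hsm, hc, heq⟩ := hact
  have hχ : ContMDiff 𝓘(ℝ, ℝ) (ModelWithCorners.pi fun _ : Fin N => 𝓡 1) ∞
      (fun t : ℝ => h (Multiplicative.ofAdd (t • ξ))) := by
    refine ContMDiff.pi_of_components fun i => Circle.contMDiff_of_continuous_add _ ?_ ?_
    · exact (continuous_apply i).comp (hc.comp (by fun_prop))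
    · intro s t
      simp only [add_smul, ofAdd_add, map_mul, Pi.mul_apply]
  have := hsm.comp ((hχ.comp contMDiff_fst).prodMk
    (contMDiff_snd (I := 𝓘(ℝ, ℝ)) (J := 𝓘(ℝ, E)) (M := ℝ) (N := M)))
  convert! this using 1
  funext q
  simp [Function.uncurry, heq]

/-- The differentials of the maps of an almost periodic flow at a fixed point are uniformly
bounded. -/
theorem IsAlmostPeriodic.exists_bound [T2Space M] [IsManifold 𝓘(ℝ, E) ∞ M]
    (hact : IsAlmostPeriodic E M n) (ξ : EuclideanSpace ℝ (Fin n)) (p : M)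
    (hp : ∀ t : ℝ, (t • ξ) +ᵥ p = p) :
    ∃ C, ∀ t : ℝ, ‖fixedPointDifferential (E := E) (fun x : M => (t • ξ) +ᵥ x) p‖ ≤ C := by
  obtain ⟨N, act, h, hsm, hc, heq⟩ := hact
  let e : (Fin N → ℝ) → (Fin N → Circle) := fun a i => Circle.exp (a i)
  have he : ContMDiff 𝓘(ℝ, Fin N → ℝ) (ModelWithCorners.pi fun _ : Fin N => 𝓡 1) ∞ e :=
    ContMDiff.pi_of_components fun i => contMDiff_circleExp.comp
      (contDiff_apply ℝ ℝ i).contMDiff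
  let f : (Fin N → ℝ) → M → M := fun a x => e a • x
  have hf : ContMDiff (𝓘(ℝ, Fin N → ℝ).prod 𝓘(ℝ, E)) 𝓘(ℝ, E) ∞ (Function.uncurry f) :=
    hsm.comp ((he.comp contMDiff_fst).prodMk contMDiff_snd)
  -- The box covers the torus under the exponential. Only parameters fixing `p` are kept, since
  -- continuity of the differential is available there; they form a closed set.
  have hK : IsCompact (Set.Icc (fun _ : Fin N => -Real.pi) (fun _ => Real.pi) ∩
      {a | f a p = p}) := by
    refine isCompact_Icc.inter_right (isClosed_eq ?_ continuous_const)
    exact hf.continuous.comp (continuous_id.prodMk continuous_const)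
  obtain ⟨C, hC⟩ := hK.exists_bound_of_continuousOn
    ((continuousOn_fixedPointDifferential (E := E) f hf p).mono Set.inter_subset_right)
  refine ⟨C, fun t => ?_⟩
  set g := h (Multiplicative.ofAdd (t • ξ)) with hg
  let a : Fin N → ℝ := fun i => Complex.arg (g i)
  have hea : e a = g := funext fun i => Circle.exp_arg (g i)
  have hfa : f a = fun x : M => (t • ξ) +ᵥ x := by
    funext x
    rw [heq, ← hg, ← hea]
  rw [← hfa]
  refine hC a ⟨⟨fun i => (Complex.neg_pi_lt_arg _).le, fun i => Complex.arg_le_pi _⟩, ?_⟩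
  rw [Set.mem_ofPred_eq, hfa]
  exact hp t

end

end HilbertHamiltonian

/-! ### Linearizing Hamilton's equation in a chart -/

/-- If the differential of `f` is obtained from a vector field `X` by contraction with a form `Ω`,
then at zeros of `X` the second derivative of `f` is the contraction of `Ω` with the
derivative of `X`. -/
theorem fderiv_fderiv_of_eventually_contraction
    {E : Type*} [NormedAddCommGroup E] [NormedSpace ℝ E]
    {f : E → ℝ} {Ω : E → E [⋀^Fin 2]→L[ℝ] ℝ} {X : E → E} {y : E}
    (hf : DifferentiableAt ℝ (fderiv ℝ f) y) (hΩ : DifferentiableAt ℝ Ω y)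
    (hX : DifferentiableAt ℝ X y) (hX0 : X y = 0)
    (h : ∀ᶠ z in 𝓝 y, ∀ v, fderiv ℝ f z v = Ω z ![X z, v]) (u v : E) :
    fderiv ℝ (fderiv ℝ f) y u v = Ω y ![fderiv ℝ X y u, v] := by
  have h1 : (fun z => fderiv ℝ f z v) =ᶠ[𝓝 y]
      fun z => Ω z (fun i => (![X, fun _ => v] : Fin 2 → E → E) i z) := by
    filter_upwards [h] with z hz
    rw [hz v]
    congr 1
    ext i; fin_cases i <;> rfl
  have h2 : fderiv ℝ (fun z => fderiv ℝ f z v) y u = fderiv ℝ (fderiv ℝ f) y u v := by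
    rw [fderiv_clm_apply hf (differentiableAt_const v)]
    simp
  -- Of the three terms of the product rule, those differentiating `Ω` and the constant `v` keep the
  -- entry `X y = 0` and vanish.
  rw [← h2, h1.fderiv_eq, fderiv_continuousAlternatingMap_apply_apply hΩ
    (by intro i; fin_cases i; exacts [hX, differentiableAt_const v]), Fin.sum_univ_two,
    (fderiv ℝ Ω y u).map_coord_zero 0 (by simpa using hX0), zero_add,
    (Ω y).map_coord_zero (m := Function.update _ 1 _) 0 (by simpa using hX0), add_zero]
  congr 1
  ext i; fin_cases i <;> simp

namespace IsSmoothFlow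

variable {E : Type*} [NormedAddCommGroup E] [NormedSpace ℝ E]
  {M : Type*} [TopologicalSpace M] [ChartedSpace E M]

/-- The local representative of a flow in the chart at `p`. -/
noncomputable def inChart (φ : ℝ → M → M) (p : M) (q : ℝ × E) : E :=
  extChartAt 𝓘(ℝ, E) p (φ q.1 ((extChartAt 𝓘(ℝ, E) p).symm q.2))

variable [IsManifold 𝓘(ℝ, E) ∞ M] {φ : ℝ → M → M}

theorem contDiffAt_inChart (h : IsSmoothFlow (E := E) φ) {p : M} {t : ℝ} {y : E}
    (hy : y ∈ (extChartAt 𝓘(ℝ, E) p).target)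
    (hφ : φ t ((extChartAt 𝓘(ℝ, E) p).symm y) ∈ (extChartAt 𝓘(ℝ, E) p).source) :
    ContDiffAt ℝ ∞ (inChart φ p) (t, y) := by
  have h1 : ContMDiffAt (𝓘(ℝ, ℝ).prod 𝓘(ℝ, E)) 𝓘(ℝ, E) ∞
      (fun q : ℝ × E => (extChartAt 𝓘(ℝ, E) p).symm q.2) (t, y) :=
    ((contMDiffOn_extChartAt_symm p).contMDiffAt
      ((isOpen_extChartAt_target p).mem_nhds hy)).comp (t, y) contMDiffAt_snd
  have h2 := h.smooth.contMDiffAt (x := (t, (extChartAt 𝓘(ℝ, E) p).symm y))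
  have h3 : ContMDiffAt (𝓘(ℝ, ℝ).prod 𝓘(ℝ, E)) 𝓘(ℝ, E) ∞
      (fun q : ℝ × E => φ q.1 ((extChartAt 𝓘(ℝ, E) p).symm q.2)) (t, y) :=
    ContMDiffAt.comp (t, y) h2 (ContMDiffAt.prodMk contMDiffAt_fst h1)
  rw [extChartAt_source] at hφ
  have h4 : ContMDiffAt (𝓘(ℝ, ℝ).prod 𝓘(ℝ, E)) 𝓘(ℝ, E) ∞ (inChart φ p) (t, y) :=
    ContMDiffAt.comp (t, y) (contMDiffAt_extChartAt' (I := 𝓘(ℝ, E)) (n := ∞) hφ) h3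
  rw [← modelWithCornersSelf_prod, chartedSpaceSelf_prod] at h4
  exact h4.contDiffAt

/-- The time derivative of the local representative is the local representative of the generating
vector field. -/
theorem fderiv_inChart_time (h : IsSmoothFlow (E := E) φ) {p : M} {y : E}
    (hy : y ∈ (extChartAt 𝓘(ℝ, E) p).target) :
    fderiv ℝ (inChart φ p) (0, y) (1, 0) =
      mfderiv 𝓘(ℝ, E) 𝓘(ℝ, E) (extChartAt 𝓘(ℝ, E) p) ((extChartAt 𝓘(ℝ, E) p).symm y)
        (mfderiv 𝓘(ℝ, ℝ) 𝓘(ℝ, E) (fun t => φ t ((extChartAt 𝓘(ℝ, E) p).symm y)) 0 (1 : ℝ) : E) := by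
  have : IsManifold 𝓘(ℝ, E) 1 M := IsManifold.of_le (n := ∞) (by simp)
  set x := (extChartAt 𝓘(ℝ, E) p).symm y with hx
  have hxs : x ∈ (extChartAt 𝓘(ℝ, E) p).source := (extChartAt 𝓘(ℝ, E) p).map_target hy
  have hd : HasFDerivAt (inChart φ p) (fderiv ℝ (inChart φ p) (0, y)) (0, y) :=
    ((h.contDiffAt_inChart hy (by rwa [h.zero])).differentiableAt (by simp)).hasFDerivAt
  have h1 : HasFDerivAt (fun t : ℝ => extChartAt 𝓘(ℝ, E) p (φ t x))
      ((fderiv ℝ (inChart φ p) (0, y)).comp (.inl ℝ ℝ E)) 0 :=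
    hd.comp (f := fun t : ℝ => (t, y)) (0 : ℝ) (hasFDerivAt_prodMk_left (0 : ℝ) y)
  have h2 := mfderiv_comp_apply_of_eq (I := 𝓘(ℝ, ℝ)) (I' := 𝓘(ℝ, E)) (I'' := 𝓘(ℝ, E)) (0 : ℝ)
    (g := extChartAt 𝓘(ℝ, E) p) (f := fun t => φ t x)
    (mdifferentiableAt_extChartAt (by rwa [← extChartAt_source 𝓘(ℝ, E)]))
    ((h.contMDiff_orbit x).mdifferentiable (by simp) 0) (h.zero x) (1 : ℝ)
  rw [mfderiv_eq_fderiv] at h2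
  refine Eq.trans ?_ h2
  have h3 : fderiv ℝ (extChartAt 𝓘(ℝ, E) p ∘ fun t => φ t x) 0 = _ := h1.fderiv
  rw [h3]
  rfl

/-- The space derivative of the local representative at a fixed point. -/
theorem fderiv_inChart_space (h : IsSmoothFlow (E := E) φ) {p : M} (hp : ∀ t, φ t p = p)
    (t : ℝ) (u : E) :
    fderiv ℝ (inChart φ p) (t, extChartAt 𝓘(ℝ, E) p p) (0, u) =
      fixedPointDifferential (φ t) p u := by
  have hd : HasFDerivAt (inChart φ p) (fderiv ℝ (inChart φ p) (t, extChartAt 𝓘(ℝ, E) p p))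
      (t, extChartAt 𝓘(ℝ, E) p p) :=
    ((h.contDiffAt_inChart (mem_extChartAt_target p)
      (by simp [hp])).differentiableAt (by simp)).hasFDerivAt
  have h1 := hd.comp (extChartAt 𝓘(ℝ, E) p p) (hasFDerivAt_prodMk_right t _)
  have h2 : fderiv ℝ (writtenInExtChartAt 𝓘(ℝ, E) 𝓘(ℝ, E) p (φ t)) (extChartAt 𝓘(ℝ, E) p p) =
      (fderiv ℝ (inChart φ p) (t, extChartAt 𝓘(ℝ, E) p p)).comp (.inr ℝ ℝ E) := by
    refine HasFDerivAt.fderiv ?_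
    convert! h1 using 1
    funext y
    simp [writtenInExtChartAt, inChart, hp]
  have h3 : fixedPointDifferential (φ t) p =
      fderivWithin ℝ (writtenInExtChartAt 𝓘(ℝ, E) 𝓘(ℝ, E) p (φ t)) (Set.range 𝓘(ℝ, E))
        (extChartAt 𝓘(ℝ, E) p p) :=
    if_pos ((h.contMDiff_map t).mdifferentiable (by simp) p)
  rw [modelWithCornersSelf_coe, Set.range_id, fderivWithin_univ] at h3
  rw [h3, h2]
  simp

/-- The linearization at a fixed point of the local representative of the generating vector field
is the infinitesimal generator of the linearized flow. -/
theorem fderiv_fderiv_inChart (h : IsSmoothFlow (E := E) φ) {p : M} (hp : ∀ t, φ t p = p) (u : E) :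
    fderiv ℝ (fun y => fderiv ℝ (inChart φ p) (0, y) (1, 0)) (extChartAt 𝓘(ℝ, E) p p) u =
      deriv (fun t => fixedPointDifferential (E := E) (φ t) p) 0 u := by
  set y₀ := extChartAt 𝓘(ℝ, E) p p
  have hF : ContDiffAt ℝ 2 (inChart φ p) (0, y₀) :=
    (h.contDiffAt_inChart (mem_extChartAt_target p) (by simp [hp])).of_le
      ENat.LEInfty.out
  have hd : HasFDerivAt (fderiv ℝ (inChart φ p)) (fderiv ℝ (fderiv ℝ (inChart φ p)) (0, y₀))
      (0, y₀) :=
    ((hF.fderiv_right (m := 1) (by norm_num)).differentiableAt (by simp)).hasFDerivAt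
  -- Both sides are mixed second partials of the local flow: space after time on the left, time
  -- after space on the right.
  have hs : IsSymmSndFDerivAt ℝ (inChart φ p) (0, y₀) :=
    hF.isSymmSndFDerivAt (by simp)
  have h1 : HasFDerivAt (fun y => fderiv ℝ (inChart φ p) (0, y))
      ((fderiv ℝ (fderiv ℝ (inChart φ p)) (0, y₀)).comp (.inr ℝ ℝ E)) y₀ :=
    hd.comp y₀ (hasFDerivAt_prodMk_right (0 : ℝ) y₀)
  have h2 : HasFDerivAt (fun t => fderiv ℝ (inChart φ p) (t, y₀))
      ((fderiv ℝ (fderiv ℝ (inChart φ p)) (0, y₀)).comp (.inl ℝ ℝ E)) (0 : ℝ) :=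
    hd.comp (0 : ℝ) (hasFDerivAt_prodMk_left (0 : ℝ) y₀)
  have h3 : HasDerivAt (fun t : ℝ => fixedPointDifferential (E := E) (φ t) p u)
      (fderiv ℝ (fderiv ℝ (inChart φ p)) (0, y₀) (1, 0) (0, u)) 0 := by
    have := (h2.clm_apply (hasFDerivAt_const ((0 : ℝ), u) (0 : ℝ))).hasDerivAt
    convert! this using 1
    · funext t
      exact (h.fderiv_inChart_space hp t u).symm
    · simp
  have h4 := (h.hasDerivAt_fixedPointDifferential hp 0).differentiableAt.hasDerivAt.clm_apply
    (hasDerivAt_const (0 : ℝ) u)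
  rw [(h1.clm_apply (hasFDerivAt_const ((1 : ℝ), (0 : E)) y₀)).fderiv]
  have h5 := h3.unique h4
  rw [hs.eq] at h5
  simpa using h5

end IsSmoothFlow

namespace HilbertHamiltonian
section
variable {E : Type*} [NormedAddCommGroup E] [InnerProductSpace ℝ E]
  {M : Type*} [TopologicalSpace M] [ChartedSpace E M]

/-- The Hessian at `p`, as the second derivative at `p` of the representative in the chart at `p`. -/
noncomputable def chartHessian (f : M → ℝ) (p : M) : E →L[ℝ] E →L[ℝ] ℝ :=
  fderiv ℝ (fderiv ℝ (f ∘ (extChartAt 𝓘(ℝ, E) p).symm)) (extChartAt 𝓘(ℝ, E) p p)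

variable [IsManifold 𝓘(ℝ, E) ∞ M]

theorem hessian_eq_chartHessian (f : M → ℝ) (p : M) (u v : E) :
    hessian (E := E) f p u v = chartHessian f p u v := by
  have : IsManifold 𝓘(ℝ, E) 1 M := IsManifold.of_le (n := ∞) (by simp)
  unfold hessian
  rw [mfderiv_extChartAt_self]
  rfl

theorem contDiffAt_comp_extChartAt_symm {f : M → ℝ} (hf : ContMDiff 𝓘(ℝ, E) 𝓘(ℝ, ℝ) ∞ f) (p : M)
    {y : E} (hy : y ∈ (extChartAt 𝓘(ℝ, E) p).target) :
    ContDiffAt ℝ ∞ (f ∘ (extChartAt 𝓘(ℝ, E) p).symm) y :=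
  (hf.contMDiffAt.comp y ((contMDiffOn_extChartAt_symm p).contMDiffAt
    ((isOpen_extChartAt_target p).mem_nhds hy))).contDiffAt

theorem chartHessian_symm {f : M → ℝ} (hf : ContMDiff 𝓘(ℝ, E) 𝓘(ℝ, ℝ) ∞ f) (p : M) (u v : E) :
    chartHessian (E := E) f p u v = chartHessian f p v u :=
  ((contDiffAt_comp_extChartAt_symm hf p (mem_extChartAt_target p)).isSymmSndFDerivAt
    (by simpa using (ENat.LEInfty.out : (2 : ℕ∞ω) ≤ ∞))).eq u v

/-- The Hamiltonian equation, written in a chart. -/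
theorem fderiv_eq_inChart_apply {Ω : TwoForm E M} {f : M → ℝ} {φ : ℝ → M → M}
    (hf : ContMDiff 𝓘(ℝ, E) 𝓘(ℝ, ℝ) ∞ f) (hφ : IsSmoothFlow (E := E) φ)
    (hham : ∀ (x : M) (v : TangentSpace 𝓘(ℝ, E) x), mfderiv 𝓘(ℝ, E) 𝓘(ℝ, ℝ) f x v =
      Ω x ![(mfderiv 𝓘(ℝ, ℝ) 𝓘(ℝ, E) (fun t : ℝ => φ t x) 0 (1 : ℝ) : E), v])
    (p : M) {y : E} (hy : y ∈ (extChartAt 𝓘(ℝ, E) p).target) (v : E) :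
    fderiv ℝ (f ∘ (extChartAt 𝓘(ℝ, E) p).symm) y v =
      Ω.inChart p y ![fderiv ℝ (IsSmoothFlow.inChart φ p) (0, y) (1, 0), v] := by
  have : IsManifold 𝓘(ℝ, E) 1 M := IsManifold.of_le (n := ∞) (by simp)
  set x := (extChartAt 𝓘(ℝ, E) p).symm y with hx
  have hsymm : MDifferentiableAt 𝓘(ℝ, E) 𝓘(ℝ, E) (extChartAt 𝓘(ℝ, E) p).symm y :=
    ((contMDiffOn_extChartAt_symm (n := ∞) p).contMDiffAt
      ((isOpen_extChartAt_target p).mem_nhds hy)).mdifferentiableAt (by simp)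
  have h1 := mfderiv_comp_apply (I := 𝓘(ℝ, E)) (I' := 𝓘(ℝ, E)) (I'' := 𝓘(ℝ, ℝ)) y
    (g := f) (f := (extChartAt 𝓘(ℝ, E) p).symm) (hf.mdifferentiable (by simp) _) hsymm v
  rw [mfderiv_eq_fderiv] at h1
  refine h1.trans ((hham x _).trans ?_)
  -- The pullback in `Ω.inChart` cancels the chart differential contained in `fderiv_inChart_time`.
  have h2 := mfderivWithin_extChartAt_symm_comp_mfderiv_extChartAt (I := 𝓘(ℝ, E)) hy
  rw [modelWithCornersSelf_coe, Set.range_id, mfderivWithin_univ] at h2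
  rw [hφ.fderiv_inChart_time hy, TwoForm.inChart]
  have h3 := DFunLike.congr_fun h2
    (mfderiv 𝓘(ℝ, ℝ) 𝓘(ℝ, E) (fun t : ℝ => φ t x) 0 (1 : ℝ) : E)
  refine congrArg (Ω x) (funext fun i => ?_)
  fin_cases i
  · exact h3.symm
  · rfl

/-- At a common fixed point of a Hamiltonian flow, the Hessian of the Hamiltonian is the contraction
of the symplectic form with the infinitesimal generator of the linearized flow. -/
theorem chartHessian_eq {Ω : TwoForm E M}
    (hΩ : ∀ x₀ : M, ContDiffOn ℝ ∞ (Ω.inChart x₀) (extChartAt 𝓘(ℝ, E) x₀).target)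
    {f : M → ℝ} {φ : ℝ → M → M}
    (hf : ContMDiff 𝓘(ℝ, E) 𝓘(ℝ, ℝ) ∞ f) (hφ : IsSmoothFlow (E := E) φ)
    (hham : ∀ (x : M) (v : TangentSpace 𝓘(ℝ, E) x), mfderiv 𝓘(ℝ, E) 𝓘(ℝ, ℝ) f x v =
      Ω x ![(mfderiv 𝓘(ℝ, ℝ) 𝓘(ℝ, E) (fun t : ℝ => φ t x) 0 (1 : ℝ) : E), v])
    {p : M} (hp : ∀ t, φ t p = p) (u v : E) :
    chartHessian f p u v =
      Ω p ![(deriv (fun t => fixedPointDifferential (E := E) (φ t) p) 0 u : E), v] := by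
  have : IsManifold 𝓘(ℝ, E) 1 M := IsManifold.of_le (n := ∞) (by simp)
  set y₀ := extChartAt 𝓘(ℝ, E) p p with hy₀
  have hmem : y₀ ∈ (extChartAt 𝓘(ℝ, E) p).target := mem_extChartAt_target p
  have hX : DifferentiableAt ℝ (fun y => fderiv ℝ (IsSmoothFlow.inChart φ p) (0, y) (1, 0)) y₀ := by
    have hF : ContDiffAt ℝ ∞ (IsSmoothFlow.inChart φ p) (0, y₀) :=
      hφ.contDiffAt_inChart hmem (by simp [y₀, hp])
    have hd : DifferentiableAt ℝ (fderiv ℝ (IsSmoothFlow.inChart φ p)) (0, y₀) :=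
      (hF.fderiv_right (m := ∞) (by simp)).differentiableAt (by simp)
    exact (DifferentiableAt.comp y₀ hd (hasFDerivAt_prodMk_right (0 : ℝ) y₀).differentiableAt
      ).clm_apply (differentiableAt_const _)
  have hX0 : fderiv ℝ (IsSmoothFlow.inChart φ p) (0, y₀) (1, 0) = 0 := by
    rw [hφ.fderiv_inChart_time hmem]
    have : (fun t => φ t ((extChartAt 𝓘(ℝ, E) p).symm y₀)) = fun _ => p := by
      funext t; simp [y₀, hp]
    rw [this, mfderiv_const]
    exact map_zero _
  have hΩd : DifferentiableAt ℝ (Ω.inChart p) y₀ :=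
    ((hΩ p).contDiffAt ((isOpen_extChartAt_target p).mem_nhds hmem)).differentiableAt (by simp)
  have hfd : DifferentiableAt ℝ (fderiv ℝ (f ∘ (extChartAt 𝓘(ℝ, E) p).symm)) y₀ :=
    ((contDiffAt_comp_extChartAt_symm hf p hmem).fderiv_right (m := ∞)
      (by simp)).differentiableAt (by simp)
  have h1 := fderiv_fderiv_of_eventually_contraction hfd hΩd hX hX0
    (by
      filter_upwards [(isOpen_extChartAt_target p).mem_nhds hmem] with y hy v
      exact fderiv_eq_inChart_apply hf hφ hham p hy v) u v
  rw [hφ.fderiv_fderiv_inChart hp] at h1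
  refine h1.trans ?_
  have h2 : mfderiv 𝓘(ℝ, E) 𝓘(ℝ, E) (extChartAt 𝓘(ℝ, E) p).symm y₀ = .id ℝ E := by
    have := mfderivWithin_range_extChartAt_symm (I := 𝓘(ℝ, E)) (x := p)
    rwa [modelWithCornersSelf_coe, Set.range_id, mfderivWithin_univ] at this
  rw [TwoForm.inChart, h2]
  -- The inverse chart returns `p` only up to a propositional equality, and the type of `Ω q`
  -- depends on `q`.
  have h3 : ∀ q, q = p → ∀ w : Fin 2 → E, Ω q w = Ω p w := by
    rintro q rfl w; rfl
  exact h3 _ (extChartAt_to_inv p) _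

/-! ### Index one and negative planes -/

/-- If the index of a form is one, it has no negative definite plane but a negative vector. -/
theorem exists_neg_of_iSup_eq_one {V : Type*} [AddCommGroup V] [Module ℝ V] (H : V → V → ℝ)
    (h00 : H 0 0 = 0)
    (h : (⨆ (W : Submodule ℝ V) (_ : ∀ w ∈ W, w ≠ 0 → H w w < 0),
      Cardinal.toENat (Module.rank ℝ W)) = 1) :
    (∃ w, H w w < 0) ∧ ∀ u w : V,
      ∃ a b : ℝ, (a ≠ 0 ∨ b ≠ 0) ∧ ¬ H (a • u + b • w) (a • u + b • w) < 0 := by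
  constructor
  · by_contra! hno
    have : (⨆ (W : Submodule ℝ V) (_ : ∀ w ∈ W, w ≠ 0 → H w w < 0),
        Cardinal.toENat (Module.rank ℝ W)) ≤ 0 := by
      refine iSup₂_le fun W hW => ?_
      have : W = ⊥ := (Submodule.eq_bot_iff _).2 fun w hw => by
        by_contra h0
        exact absurd (hW w hw h0) (not_lt.2 (hno w))
      subst this
      simp
    rw [h] at this
    simp at this
  · intro u w
    by_contra! hno
    have hneg : ∀ v ∈ Submodule.span ℝ (Set.range ![u, w]), v ≠ 0 → H v v < 0 := by
      intro v hv h0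
      rw [Matrix.range_cons_cons_empty, Submodule.mem_span_pair] at hv
      obtain ⟨a, b, rfl⟩ := hv
      refine hno a b ?_
      by_contra! hab
      simp [hab.1, hab.2] at h0
    by_cases hli : LinearIndependent ℝ ![u, w]
    · have h1 := le_iSup₂_of_le (f := fun (W : Submodule ℝ V)
        (_ : ∀ w ∈ W, w ≠ 0 → H w w < 0) => Cardinal.toENat (Module.rank ℝ W)) _ hneg le_rfl
      rw [h, Cardinal.toENat_le_one] at h1
      have h2 := Module.finrank_le_of_rank_le (n := 1) (by simpa using h1)
      rw [finrank_span_eq_card hli] at h2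
      simp at h2
    -- A dependent pair has a nontrivial vanishing combination, where negativity would read `H 0 0 <
    -- 0`. Quantifying over coefficients thus encodes independence too.
    · rw [LinearIndependent.pair_iff] at hli
      push Not at hli
      obtain ⟨a, b, h0, hab⟩ := hli
      have hab' : a ≠ 0 ∨ b ≠ 0 := by
        by_contra! hc
        exact hab hc.1 hc.2
      have h1 := hno a b hab'
      rw [h0, h00] at h1
      exact lt_irrefl _ h1

end
end HilbertHamiltonian

namespace HilbertHamiltonian
section
variable {E : Type*} [NormedAddCommGroup E] [InnerProductSpace ℝ E]

/-- If a symmetric form `B` admits a bounded linear flow with surjective skew generator, then every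
negative vector lies in a negative definite plane. -/
theorem exists_plane_of_bounded_hamiltonian_flow (B : E →L[ℝ] E →L[ℝ] ℝ)
    (hsymm : ∀ u v, B u v = B v u) (A : ℝ → E →L[ℝ] E) (L : E →L[ℝ] E)
    (hskew : ∀ u, B (L u) u = 0) (hsurj : Function.Surjective L) (hA0 : A 0 = .id ℝ E)
    (hA : ∀ t, HasDerivAt A (L.comp (A t)) t) (hbdd : ∃ C, ∀ t, ‖A t‖ ≤ C)
    (w : E) (hw : B w w < 0) :
    ∃ u, ∀ a b : ℝ, (a ≠ 0 ∨ b ≠ 0) → B (a • u + b • w) (a • u + b • w) < 0 := by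
  obtain ⟨C, hC⟩ := hbdd
  refine exists_negDef_plane_of_bounded_orbit B hsymm L hskew w hw (hsurj w) (fun t => A t w)
    (by simp [hA0]) (fun t => ?_) ⟨C * ‖w‖, fun t => (A t).le_of_opNorm_le (hC t) w⟩
  simpa using (hA t).clm_apply (hasDerivAt_const t w)

end
end HilbertHamiltonian

/-! ### Proof of the main theorem -/

theorem theorem5p1p7
    {E : Type*} [NormedAddCommGroup E] [InnerProductSpace ℝ E] [CompleteSpace E]
    [TopologicalSpace.SeparableSpace E]
    {M : Type*} [TopologicalSpace M] [T2Space M] [ParacompactSpace M]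
    [ChartedSpace E M] [IsManifold 𝓘(ℝ, E) ∞ M]
    (Ω : HilbertHamiltonian.TwoForm E M) (hΩ : Ω.IsStronglySymplectic)
    (n : ℕ) [AddAction (EuclideanSpace ℝ (Fin n)) M]
    (hact : HilbertHamiltonian.IsAlmostPeriodic E M n)
    (μ : M → EuclideanSpace ℝ (Fin n)) (hμ : HilbertHamiltonian.IsMomentumMap Ω μ)
    (ξ : EuclideanSpace ℝ (Fin n))
    (hMorse : HilbertHamiltonian.IsMorse (E := E) (HilbertHamiltonian.component μ ξ))
    (p : M)
    (hp : HilbertHamiltonian.IsCriticalPoint (E := E) (HilbertHamiltonian.component μ ξ) p) :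
    HilbertHamiltonian.index (E := E) (HilbertHamiltonian.component μ ξ) p ≠ 1 ∧
      HilbertHamiltonian.coindex (E := E) (HilbertHamiltonian.component μ ξ) p ≠ 1 := by
  set f := HilbertHamiltonian.component μ ξ with hf
  have hflow := hact.isSmoothFlow ξ
  set φ : ℝ → M → M := fun t x => (t • ξ) +ᵥ x with hφ
  have hfix : ∀ t, φ t p = p := by
    refine hflow.fixed_of_velocity_eq_zero p ?_
    -- Both the zero vector and the velocity at `p` represent the zero covector, so they coincide.
    obtain ⟨u, -, hu⟩ := hΩ.nondegenerate p 0
    have h0 : (0 : TangentSpace 𝓘(ℝ, E) p) = u :=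
      hu 0 fun v => (Ω p).map_coord_zero 0 rfl
    refine Eq.trans (hu _ fun v => ?_) h0.symm
    exact (hμ.hamiltonian ξ p v).symm.trans (DFunLike.congr_fun hp v)
  set B : E →L[ℝ] E →L[ℝ] ℝ := HilbertHamiltonian.chartHessian f p with hB
  have hess : ∀ u v : E, HilbertHamiltonian.hessian (E := E) f p u v = B u v :=
    HilbertHamiltonian.hessian_eq_chartHessian f p
  set A : ℝ → E →L[ℝ] E := fun t => fixedPointDifferential (φ t) p with hA
  set L := deriv A 0 with hL
  have hBL : ∀ u v : E, B u v = Ω p ![(L u : E), v] := fun u v =>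
    HilbertHamiltonian.chartHessian_eq hΩ.smooth hMorse.1 hflow (hμ.hamiltonian ξ) hfix u v
  have hsymm : ∀ u v, B u v = B v u := HilbertHamiltonian.chartHessian_symm hMorse.1 p
  -- By symmetry, `B (L u) u = B u (L u) = Ω(L u, L u)`.
  have hskew : ∀ u, B (L u) u = 0 := fun u => by
    rw [hsymm, hBL]
    exact (Ω p).map_eq_zero_of_eq _ (i := 0) (j := 1) rfl (by decide)
  -- The Morse condition solves `B u · = Ω(w, ·)` for `u`; then `Ω(L u, ·) = Ω(w, ·)` forces `L u =
  -- w`.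
  have hsurj : Function.Surjective L := by
    intro w
    let l : E →L[ℝ] ℝ := (Ω p).toContinuousMultilinearMap.toContinuousLinearMap
      (![w, 0] : Fin 2 → E) 1
    have hl : ∀ v : E, l v = Ω p ![w, v] := fun v => by
      have h1 : Function.update (![w, 0] : Fin 2 → E) 1 v = ![w, v] := by
        ext i; fin_cases i <;> simp
      exact congrArg (Ω p) h1
    obtain ⟨u, hu, -⟩ := hMorse.2 p hp l
    refine ⟨u, (hΩ.nondegenerate p l).unique (fun v => ?_) fun v => (hl v).symm⟩
    exact (hBL u v).symm.trans ((hess u v).symm.trans (hu v))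
  have hA0 : A 0 = .id ℝ E := hflow.fixedPointDifferential_zero
  have hAd : ∀ t, HasDerivAt A (L.comp (A t)) t := hflow.hasDerivAt_fixedPointDifferential hfix
  have hbdd : ∃ C, ∀ t, ‖A t‖ ≤ C := hact.exists_bound ξ p hfix
  constructor
  · intro hidx
    obtain ⟨⟨w, hw⟩, hno⟩ := HilbertHamiltonian.exists_neg_of_iSup_eq_one (V := E)
      (HilbertHamiltonian.hessian (E := E) f p) ((hess 0 0).trans (by simp)) hidx
    obtain ⟨u, hu⟩ := HilbertHamiltonian.exists_plane_of_bounded_hamiltonian_flow B hsymm A L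
      hskew hsurj hA0 hAd hbdd w ((hess w w).symm.trans_lt hw)
    obtain ⟨a, b, hab, h⟩ := hno u w
    exact h ((hess _ _).trans_lt (hu a b hab))
  -- The coindex is the index of `-B`, for which `L` is still skew; the flow and the surjectivity of
  -- `L` do not involve the sign.
  · intro hidx
    obtain ⟨⟨w, hw⟩, hno⟩ := HilbertHamiltonian.exists_neg_of_iSup_eq_one (V := E)
      (fun u v => - HilbertHamiltonian.hessian (E := E) f p u v)
      (neg_eq_zero.2 ((hess 0 0).trans (by simp)))
      (by simp only [neg_neg_iff_pos]; exact hidx)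
    obtain ⟨u, hu⟩ := HilbertHamiltonian.exists_plane_of_bounded_hamiltonian_flow (-B)
      (fun u v => by simp [hsymm u v]) A L (fun u => by simp [hskew u])
      hsurj hA0 hAd hbdd w ((congrArg Neg.neg (hess w w)).symm.trans_lt hw)
    obtain ⟨a, b, hab, h⟩ := hno u w
    exact h ((congrArg Neg.neg (hess _ _)).trans_lt (hu a b hab))
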